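/- Let $M\ge 0$ and $B\ge 1$ be integers, let $\mathbf h$ be a random vector in $\mathbb C^M$ with law $\mathcal{CN}(\mathbf 0,\mathbf R_{\mathbf h})$ (circularly symmetric complex Gaussian with covariance matrix $\mathbf R_{\mathbf h}$), let $\mathbf W_{\rm O}\in\mathbb C^{M\times B}$ be an arbitrary beam codebook, and put $\bar{\mathbf h}=\mathbf W_{\rm O}^{\rm H}\mathbf h$ and $\mathbf R_{\bar{\mathbf h}}=\mathbf W_{\rm O}^{\rm H}\mathbf R_{\mathbf h}\mathbf W_{\rm O}$. Let $P>0$, $R_{\rm th}\ge 0$ and $\alpha_{\rm th}=(2^{R_{\rm th}}-1)/P$. For $1\le b\le B$ let $\mathbb A_b=\{1,\dots,b\}$ and let $\bar{\mathbf h}_{\mathbb A_b}$ be the vector of the first $b$ entries of $\bar{\mathbf h}$. Beam-domain interleaved training trains beam $1$ and then, as long as $l$ beams have been trained with $\|\bar{\mathbf h}_{\mathbb A_l}\|^2<\alpha_{\rm th}$ and $l<B$, trains beam $l+1$; the training length is the number of beams trained when it stops, and $L_t$ is its expectation. Let $\tilde{\mathbf R}_b$ be the matrix of the first $b$ rows of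 the positive semidefinite square root $\mathbf R_{\bar{\mathbf h}}^{1/2}$, let $\tilde{\mathbf R}_b^{\rm H}\tilde{\mathbf R}_b=\mathbf U_b\,{\rm diag}(\delta_{b,1},\dots,\delta_{b,r_b})\,\mathbf U_b^{\rm H}$ be a compact eigenvalue decomposition, where $r_b$ is the rank, $\mathbf U_b^{\rm H}\mathbf U_b=\mathbf I$ and all $\delta_{b,j}>0$, and let $\bar\delta_{b,1},\dots,\bar\delta_{b,T_b}$ be the distinct values among the $\delta_{b,j}$, with multiplicities $r_{b,1},\dots,r_{b,T_b}$. For $\alpha\in\mathbb R$ define $$F_b(\alpha)=\prod_{t=1}^{T_b}\Big(\frac1{\bar\delta_{b,t}}\Big)^{r_{b,t}}\sum_{k=1}^{T_b}\sum_{s=1}^{r_{b,k}}(-1)^{r_{b,k}-s}\,\bar\delta_{b,k}^{\,r_{b,k}-s+1}\,\Psi_{b,k,s,\mathbf r_b}\Big[1-e^{-\alpha/\bar\delta_{b,k}}\sum_{u=0}^{r_{b,k}-s}\frac{(\alpha/\bar\delta_{b,k})^u}{u!}\Big],$$ $$\Psi_{b,k,s,\mathbf r_b}=(-1)^{r_{b,k}-1}\sum_{\mathbf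 i\in\Omega_{b,k,s}}\ \prod_{n\ne k}\binom{i_n+r_{b,n}-1}{i_n}\Big(\frac1{\bar\delta_{b,n}}-\frac1{\bar\delta_{b,k}}\Big)^{-(i_n+r_{b,n})},$$ $$\Omega_{b,k,s}=\Big\{\mathbf i\in\mathbb Z_{\ge0}^{T_b}:\ \sum_{j=1}^{T_b} i_j=s-1,\ i_k=0\Big\}.$$ Then: 1. The training length is integrable and $L_t=1+\sum_{b=1}^{B-1}\Pr\big(\|\bar{\mathbf h}_{\mathbb A_b}\|^2<\alpha_{\rm th}\big)$. 2. For $1\le b\le B$, $\|\bar{\mathbf h}_{\mathbb A_b}\|^2$ has the same distribution as $\sum_{t=1}^{T_b}\tfrac12\bar\delta_{b,t}Q_{b,t}$, where $Q_{b,1},\dots,Q_{b,T_b}$ are independent and $Q_{b,t}\sim\chi^2(2r_{b,t})$. 3. For $1\le b\le B$ with $r_b\ge1$, $\Pr\big(\|\bar{\mathbf h}_{\mathbb A_b}\|^2<\alpha_{\rm th}\big)=F_b(\alpha_{\rm th})$. 4. If $r_b\ge 1$ for $b=1,\dots,B-1$, then $L_t=1+\sum_{b=1}^{B-1}F_b(\alpha_{\rm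 th})$. -/

import Mathlib

open MeasureTheory ProbabilityTheory
open scoped Matrix MatrixOrder ComplexConjugate

noncomputable section

namespace InterleavedTraining

/-- `X ∼ 𝒞𝒩(0, R)`: the complex random vector `X` is circularly symmetric complex Gaussian with
covariance matrix `R`, i.e. its real and imaginary parts are jointly Gaussian, it has mean `0`,
`E[X Xᴴ] = R`, and `E[X Xᵀ] = 0`. -/
structure IsCircularGaussian {Ω : Type*} [MeasurableSpace Ω] {n : ℕ} (X : Ω → Fin n → ℂ)
    (R : Matrix (Fin n) (Fin n) ℂ) (μ : Measure Ω) : Prop where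
  gaussian : HasGaussianLaw X μ
  mean : ∀ i, ∫ ω, X ω i ∂μ = 0
  covariance : ∀ i j, ∫ ω, X ω i * conj (X ω j) ∂μ = R i j
  pseudoCovariance : ∀ i j, ∫ ω, X ω i * X ω j ∂μ = 0

/-- The chi-squared distribution with `k` degrees of freedom: the law of the sum of the squares of
`k` independent standard normal variables. -/
def chiSquared (k : ℕ) : Measure ℝ :=
  (Measure.pi fun _ : Fin k => gaussianReal 0 1).map fun z => ∑ i, z i ^ 2

/-- The normalized SNR threshold `α_th = (2 ^ R_th - 1) / P`. -/
def snrThreshold (P Rth : ℝ) : ℝ := (2 ^ Rth - 1) / P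

/-! ### The training scheme -/

/-- The index set `𝔸_l = {1, …, l}` (here: the first `l` elements of `Fin L`) of the
beams trained in the first `l` steps. -/
def trainedSet (L l : ℕ) : Finset (Fin L) := Finset.univ.filter fun n => n.val < l

/-- `‖x_{𝔸_l}‖²`: squared Euclidean norm of the sub-vector of the trained entries. -/
def trainedNormSq {L : ℕ} (x : Fin L → ℂ) (l : ℕ) : ℝ :=
  ‖WithLp.toLp 2 fun n : trainedSet L l => x n‖ ^ 2

open Classical in
/-- The loop of the training algorithm, entered with `l` trained beams: while
`‖x_{𝔸_l}‖² < α` and `l < L`, train one more beam. The value is the number of trained beams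
when the loop ends. -/
def trainingLoop {L : ℕ} (α : ℝ) (x : Fin L → ℂ) (l : ℕ) : ℕ :=
  if trainedNormSq x l < α ∧ l < L then trainingLoop α x (l + 1) else l
termination_by L - l
decreasing_by omega

/-- The training length for the channel realization `x`: the first beam is always trained, and then
the loop is run. -/
def trainingLength {L : ℕ} (α : ℝ) (x : Fin L → ℂ) : ℕ := trainingLoop α x 1

/-! ### The beam-domain channel and its covariance -/

/-- The beam-domain channel `W_Oᴴ h`. -/
def beamChannel {M B : ℕ} (W : Matrix (Fin M) (Fin B) ℂ) (h : Fin M → ℂ) : Fin B → ℂ :=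
  Wᴴ *ᵥ h

/-- The covariance matrix `W_Oᴴ R_h W_O` of the beam-domain channel. -/
def beamCovariance {M B : ℕ} (W : Matrix (Fin M) (Fin B) ℂ) (R : Matrix (Fin M) (Fin M) ℂ) :
    Matrix (Fin B) (Fin B) ℂ :=
  Wᴴ * R * W

/-- The rows with index in `𝔸_b` of the positive semidefinite square root of the beam-domain
covariance matrix. -/
def sqrtRows {M B : ℕ} (W : Matrix (Fin M) (Fin B) ℂ) (R : Matrix (Fin M) (Fin M) ℂ) (b : ℕ) :
    Matrix (trainedSet B b) (Fin B) ℂ :=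
  (CFC.sqrt (beamCovariance W R)).submatrix Subtype.val id

/-- A compact eigenvalue decomposition `A = U diag(δ_1, …, δ_r) Uᴴ`, with `r = rank A`,
`U` semi-unitary and all `δ_j > 0`, together with an enumeration `value 1, …, value T` of the
different numbers among `δ_1, …, δ_r` and the number of times `mult t` that `value t` occurs. -/
structure CompactEVD {n : ℕ} (A : Matrix (Fin n) (Fin n) ℂ) where
  r : ℕ
  r_eq_rank : r = A.rank
  U : Matrix (Fin n) (Fin r) ℂ
  semiunitary : Uᴴ * U = 1
  δ : Fin r → ℝ
  δ_pos : ∀ j, 0 < δ j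
  decomposition : A = U * Matrix.diagonal (fun j => (δ j : ℂ)) * Uᴴ
  T : ℕ
  value : Fin T → ℝ
  value_injective : Function.Injective value
  range_value : Set.range value = Set.range δ
  mult : Fin T → ℕ
  mult_eq : ∀ t, mult t = (Finset.univ.filter fun j => δ j = value t).card

/-! ### The closed form -/

/-- `Ω_{k,s}`: the vectors of nonnegative integers with sum `s - 1` and `k`-th entry `0`. -/
def indexSet {T : ℕ} (k : Fin T) (s : ℕ) : Finset (Fin T → ℕ) :=
  (Finset.piAntidiag Finset.univ (s - 1)).filter fun i => i k = 0

/-- The coefficient `Ψ_{k,s,r}` for the values `δ_1, …, δ_T` with multiplicities `r_1, …, r_T`. -/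
def Psi {T : ℕ} (δ : Fin T → ℝ) (r : Fin T → ℕ) (k : Fin T) (s : ℕ) : ℝ :=
  (-1) ^ (r k - 1) * ∑ i ∈ indexSet k s, ∏ n ∈ Finset.univ.erase k,
    ((i n + r n - 1).choose (i n) : ℝ) * (1 / δ n - 1 / δ k) ^ (-((i n + r n : ℕ) : ℤ))

/-- The closed form of the distribution function at `α`, for the values `δ_1, …, δ_T` with
multiplicities `r_1, …, r_T`. -/
def closedFormCDF {T : ℕ} (δ : Fin T → ℝ) (r : Fin T → ℕ) (α : ℝ) : ℝ :=
  (∏ t, (1 / δ t) ^ r t) * ∑ k, ∑ s ∈ Finset.Icc 1 (r k),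
    (-1) ^ (r k - s) * δ k ^ (r k - s + 1) * Psi δ r k s *
      (1 - Real.exp (-(α / δ k)) *
        ∑ u ∈ Finset.range (r k - s + 1), (α / δ k) ^ u / (u.factorial : ℝ))

end InterleavedTraining

end

open InterleavedTraining

/-! The trained norm is nondecreasing in the number of beams, so the loop passes a stage `b < B`
exactly when the norm at `b` is below the threshold. The training length is therefore 1 plus a sum
of indicators, and its mean follows by linearity.

For the law of the norm, let `A` be the trained rows of the square root, so that the trained
subvector `g` has covariance `A Aᴴ`. With `AᴴA = U diag(δ) Uᴴ`, the vector `w = diag(δ)⁻¹ Uᴴ Aᴴ g`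
is standard circular Gaussian and `g = A U w` almost surely, whence `‖g‖² = ∑ δ_j |w_j|²`. Its
characteristic function `∏ (1 - iuδ_j)⁻¹`, grouped by distinct values, is that of the weighted
chi-squared sum (`charFun_map_trainedNormSq`, `map_trainedNormSq`).

For the closed form, the partial fraction expansion of `∏ (z + 1/δ_t)^(-r_t)` at `z = -iu`
(`prod_inv_pow_eq_sum`) writes this characteristic function as a real combination of those of gamma
laws with integer shape. Uniqueness transfers the identity to measures, even with negative
coefficients (`measureReal_eq_sum_of_charFun_eq_sum`), and each gamma distribution function is
elementary. `Psi` is, up to sign, a Taylor coefficient, at the pole `-1/δ_k`, of the product of the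
other factors. -/

namespace InterleavedTraining

/-! ### Training length as a sum of indicators -/

lemma trainedNormSq_eq_sum {L : ℕ} (x : Fin L → ℂ) (l : ℕ) :
    trainedNormSq x l = ∑ n ∈ trainedSet L l, ‖x n‖ ^ 2 := by
  rw [trainedNormSq, EuclideanSpace.norm_sq_eq]
  exact Finset.sum_coe_sort (trainedSet L l) fun n => ‖x n‖ ^ 2

lemma trainedNormSq_mono {L : ℕ} (x : Fin L → ℂ) : Monotone (trainedNormSq x) := by
  intro l m hlm
  simp only [trainedNormSq_eq_sum]
  refine Finset.sum_le_sum_of_subset_of_nonneg (fun n hn => ?_) fun _ _ _ => by positivity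
  simp only [trainedSet, Finset.mem_filter] at hn ⊢
  exact ⟨hn.1, hn.2.trans_le hlm⟩

lemma continuous_trainedNormSq {L : ℕ} (l : ℕ) :
    Continuous fun x : Fin L → ℂ => trainedNormSq x l := by
  simp only [trainedNormSq_eq_sum]
  fun_prop

open Classical in
-- By monotonicity, once the norm reaches `α` all later indicators vanish, so counting every stage
-- below `α` agrees with stopping at the first failure.
lemma trainingLoop_eq {L : ℕ} (α : ℝ) (x : Fin L → ℂ) (l : ℕ) (hl : l ≤ L) :
    trainingLoop α x l =
      l + ∑ b ∈ Finset.Ico l L, if trainedNormSq x b < α then 1 else 0 := by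
  induction hd : L - l generalizing l with
  | zero =>
    have : l = L := by omega
    subst this
    rw [trainingLoop]
    simp
  | succ d ih =>
    have hlt : l < L := by omega
    rw [trainingLoop]
    by_cases h : trainedNormSq x l < α
    · rw [if_pos ⟨h, hlt⟩, ih (l + 1) hlt (by omega), Finset.sum_eq_sum_Ico_succ_bot hlt, if_pos h]
      ring
    · rw [if_neg fun h' => h h'.1, Finset.sum_eq_zero, add_zero]
      intro b hb
      rw [if_neg]
      exact fun h' => h ((trainedNormSq_mono x (Finset.mem_Ico.1 hb).1).trans_lt h')

lemma trainingLength_eq_sum_indicator {L : ℕ} (hL : 1 ≤ L) (α : ℝ) (x : Fin L → ℂ) :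
    (trainingLength α x : ℝ) =
      1 + ∑ b ∈ Finset.Icc 1 (L - 1), {y | trainedNormSq y b < α}.indicator 1 x := by
  have hIco : Finset.Ico 1 L = Finset.Icc 1 (L - 1) := by
    ext b
    simp only [Finset.mem_Ico, Finset.mem_Icc]
    omega
  rw [trainingLength, trainingLoop_eq α x 1 hL, hIco]
  push_cast
  simp [Set.indicator_apply]

lemma measurableSet_trainedNormSq_lt {L : ℕ} (α : ℝ) (b : ℕ) :
    MeasurableSet {y : Fin L → ℂ | trainedNormSq y b < α} :=
  measurableSet_lt (continuous_trainedNormSq b).measurable measurable_const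

section

variable {Ω : Type*} [MeasurableSpace Ω] {μ : Measure Ω} [IsProbabilityMeasure μ] {L : ℕ}
  {X : Ω → Fin L → ℂ}

lemma integrable_indicator_trainedNormSq_lt (hX : AEMeasurable X μ) (α : ℝ) (b : ℕ) :
    Integrable (fun ω => {y | trainedNormSq y b < α}.indicator (1 : (Fin L → ℂ) → ℝ) (X ω)) μ := by
  refine Integrable.of_bound (C := 1) ?_ (ae_of_all _ fun ω => ?_)
  · exact ((measurable_one.indicator (measurableSet_trainedNormSq_lt α b)).comp_aemeasurable
      hX).aestronglyMeasurable
  · by_cases h : X ω ∈ {y | trainedNormSq y b < α} <;> simp [h]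

lemma integrable_trainingLength (hL : 1 ≤ L) (hX : AEMeasurable X μ) (α : ℝ) :
    Integrable (fun ω => (trainingLength α (X ω) : ℝ)) μ := by
  simp only [trainingLength_eq_sum_indicator hL]
  exact (integrable_const _).add
    (integrable_finsetSum _ fun b _ => integrable_indicator_trainedNormSq_lt hX α b)

lemma integral_trainingLength (hL : 1 ≤ L) (hX : AEMeasurable X μ) (α : ℝ) :
    ∫ ω, (trainingLength α (X ω) : ℝ) ∂μ =
      1 + ∑ b ∈ Finset.Icc 1 (L - 1), μ.real {ω | trainedNormSq (X ω) b < α} := by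
  simp only [trainingLength_eq_sum_indicator hL]
  rw [integral_add (integrable_const _)
      (integrable_finsetSum _ fun b _ => integrable_indicator_trainedNormSq_lt hX α b),
    integral_finsetSum _ fun b _ => integrable_indicator_trainedNormSq_lt hX α b]
  simp only [integral_const, probReal_univ, smul_eq_mul, mul_one, add_right_inj]
  refine Finset.sum_congr rfl fun b _ => ?_
  have hs : NullMeasurableSet {ω | trainedNormSq (X ω) b < α} μ :=
    hX.nullMeasurableSet_preimage (measurableSet_trainedNormSq_lt α b)
  have h := integral_indicator₀ (f := fun _ => (1 : ℝ)) hs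
  rw [setIntegral_const, smul_eq_mul, mul_one] at h
  exact h

end

/-! ### Partial fractions through power series -/

section PartialFractions

open Polynomial

/-- The power series of `(x + a)⁻ʳ`. -/
noncomputable def invPowSeries (a : ℝ) (r : ℕ) : PowerSeries ℝ :=
  PowerSeries.mk fun i => (-1) ^ i * ((i + r - 1).choose i : ℝ) * a ^ (-((i + r : ℕ) : ℤ))

/-- Writing `x + a = a (1 - (-a⁻¹) x)` reduces this to the binomial series of `(1 - x)^(-(d+1))`,
rescaled by `-a⁻¹`. -/
lemma X_add_C_pow_mul_invPowSeries {a : ℝ} (ha : a ≠ 0) {r : ℕ} (hr : 1 ≤ r) :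
    (PowerSeries.X + PowerSeries.C a) ^ r * invPowSeries a r = 1 := by
  obtain ⟨d, rfl⟩ : ∃ d, r = d + 1 := ⟨r - 1, by omega⟩
  have h := congrArg (PowerSeries.rescale (-a⁻¹))
    (PowerSeries.mk_add_choose_mul_one_sub_pow_eq_one ℝ d)
  rw [map_mul, map_pow, map_sub, map_one, PowerSeries.rescale_mk, PowerSeries.rescale_X] at h
  have h1 : invPowSeries a (d + 1) = PowerSeries.C ((a⁻¹) ^ (d + 1)) *
      PowerSeries.mk fun n => (-a⁻¹) ^ n * ((d + n).choose d : ℝ) := by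
    ext n
    rw [PowerSeries.coeff_C_mul, invPowSeries, PowerSeries.coeff_mk, PowerSeries.coeff_mk,
      show n + (d + 1) - 1 = d + n by omega, Nat.choose_symm_add, zpow_neg, zpow_natCast,
      neg_pow a⁻¹, pow_add, inv_pow, inv_pow, mul_inv]
    ring
  have h2 : (PowerSeries.X + PowerSeries.C a : PowerSeries ℝ) =
      PowerSeries.C a * (1 - PowerSeries.C (-a⁻¹) * PowerSeries.X) := by
    rw [mul_sub, ← mul_assoc, ← map_mul, mul_neg, mul_inv_cancel₀ ha, map_neg, map_one]
    ring
  have h3 : (PowerSeries.C a : PowerSeries ℝ) ^ (d + 1) * PowerSeries.C (a⁻¹ ^ (d + 1)) = 1 := by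
    rw [← map_pow, ← map_mul, ← mul_pow, mul_inv_cancel₀ ha, one_pow, map_one]
  rw [h1, h2, mul_pow]
  calc _ = (PowerSeries.C a ^ (d + 1) * PowerSeries.C (a⁻¹ ^ (d + 1))) *
        ((PowerSeries.mk fun n => (-a⁻¹) ^ n * ((d + n).choose d : ℝ)) *
          (1 - PowerSeries.C (-a⁻¹) * PowerSeries.X) ^ (d + 1)) := by ring
    _ = 1 := by rw [h3, one_mul]; exact h

variable {T : ℕ}

/-- The power series of `∏_{n ≠ k} (x + a n - a k) ^ (-r n)`. -/
noncomputable def cofactorSeries (a : Fin T → ℝ) (r : Fin T → ℕ) (k : Fin T) : PowerSeries ℝ :=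
  ∏ n ∈ Finset.univ.erase k, invPowSeries (a n - a k) (r n)

/-- Cauchy product: exponent vectors supported off `k` are the vectors with `k`-th entry `0`, and
their signs multiply to `(-1)^j`. The shift `s = j + 1` matches `indexSet`. -/
lemma coeff_cofactorSeries (a : Fin T → ℝ) (r : Fin T → ℕ) (k : Fin T) (j : ℕ) :
    PowerSeries.coeff j (cofactorSeries a r k) =
      (-1) ^ j * ∑ i ∈ indexSet k (j + 1), ∏ n ∈ Finset.univ.erase k,
        ((i n + r n - 1).choose (i n) : ℝ) * (a n - a k) ^ (-((i n + r n : ℕ) : ℤ)) := by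
  rw [cofactorSeries, PowerSeries.coeff_prod, Finset.mul_sum]
  have hsum (i : Fin T → ℕ) (hk : i k = 0) : ∑ n ∈ Finset.univ.erase k, i n = ∑ n, i n := by
    rw [← Finset.add_sum_erase _ _ (Finset.mem_univ k), hk, zero_add]
  refine Finset.sum_bij' (fun l _ => ⇑l) (fun i _ => Finsupp.equivFunOnFinite.symm i)
    (fun l hl => ?_) (fun i hi => ?_) (fun l _ => by ext; rfl) (fun i _ => rfl) (fun l hl => ?_)
  all_goals simp only [Finset.mem_finsuppAntidiag, indexSet, Finset.mem_filter,
    Finset.mem_piAntidiag, add_tsub_cancel_right] at *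
  · have hk : l k = 0 := by
      by_contra h
      exact Finset.notMem_erase k _ (hl.2 (Finsupp.mem_support_iff.2 h))
    exact ⟨⟨by rw [← hl.1, hsum l hk], fun _ _ => Finset.mem_univ _⟩, hk⟩
  · refine ⟨?_, fun n hn => Finset.mem_erase.2 ⟨?_, Finset.mem_univ _⟩⟩
    · rw [← hi.1.1]
      exact hsum i hi.2
    · rintro rfl
      exact Finsupp.mem_support_iff.1 hn hi.2
  · simp only [invPowSeries, PowerSeries.coeff_mk, mul_assoc]
    rw [Finset.prod_mul_distrib, Finset.prod_pow_eq_pow_sum]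
    congr 2
    exact hl.1

/-- The full series is the exact inverse of the cofactor, and truncation leaves the coefficients
below `r k` unchanged. -/
lemma X_pow_dvd_cofactor_mul_trunc_sub_one {a : Fin T → ℝ} (ha : Function.Injective a)
    {r : Fin T → ℕ} (hr : ∀ n, 1 ≤ r n) (k : Fin T) :
    (X : ℝ[X]) ^ r k ∣ (∏ n ∈ Finset.univ.erase k, (X + C (a n - a k)) ^ r n) *
      PowerSeries.trunc (r k) (cofactorSeries a r k) - 1 := by
  have hinv : ((∏ n ∈ Finset.univ.erase k, (X + C (a n - a k)) ^ r n : ℝ[X]) : PowerSeries ℝ) *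
      cofactorSeries a r k = 1 := by
    rw [← Polynomial.coeToPowerSeries.ringHom_apply, map_prod, cofactorSeries,
      ← Finset.prod_mul_distrib]
    refine Finset.prod_eq_one fun n hn => ?_
    rw [map_pow, map_add, Polynomial.coeToPowerSeries.ringHom_apply,
      Polynomial.coeToPowerSeries.ringHom_apply, Polynomial.coe_X, Polynomial.coe_C]
    exact X_add_C_pow_mul_invPowSeries
      (sub_ne_zero.2 (ha.ne (Finset.ne_of_mem_erase hn))) (hr n)
  rw [Polynomial.X_pow_dvd_iff]
  intro d hd
  rw [Polynomial.coeff_sub, ← Polynomial.coeff_coe, Polynomial.coe_mul, sub_eq_zero,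
    ← Polynomial.coeff_coe, Polynomial.coe_one, ← hinv, PowerSeries.coeff_mul,
    PowerSeries.coeff_mul]
  refine Finset.sum_congr rfl fun p hp => ?_
  rw [Polynomial.coeff_coe, Polynomial.coeff_coe, PowerSeries.coeff_trunc, if_pos]
  have := Finset.HasAntidiagonal.mem_antidiagonal.1 hp
  omega

/-- Partial fraction decomposition of `∏ (x + a n) ^ (-r n)`, multiplied by the denominator. -/
lemma sum_cofactor_mul_trunc_eq_one (hT : 0 < T) {a : Fin T → ℝ} (ha : Function.Injective a)
    {r : Fin T → ℕ} (hr : ∀ n, 1 ≤ r n) :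
    ∑ k, (∏ n ∈ Finset.univ.erase k, (X + C (a n)) ^ r n) *
      (PowerSeries.trunc (r k) (cofactorSeries a r k)).comp (X + C (a k)) = 1 := by
  set f : Fin T → ℝ[X] := fun k => (∏ n ∈ Finset.univ.erase k, (X + C (a n)) ^ r n) *
      (PowerSeries.trunc (r k) (cofactorSeries a r k)).comp (X + C (a k)) with hf
  have hdegN (s : Finset (Fin T)) :
      (∏ n ∈ s, (X + C (a n)) ^ r n).degree = ((∑ n ∈ s, r n : ℕ) : WithBot ℕ) := by
    rw [degree_prod]
    simp [degree_pow]
  -- Substituting `X + a k` for `X` moves the local congruence from `0` to the pole `-a k`.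
  have hdvd_self (k : Fin T) : (X + C (a k)) ^ r k ∣ f k - 1 := by
    have h := map_dvd (Polynomial.compRingHom (X + C (a k)))
      (X_pow_dvd_cofactor_mul_trunc_sub_one ha hr k)
    convert h using 1
    · simp
    · simp only [hf, coe_compRingHom_apply, sub_comp, mul_comp, one_comp, Polynomial.prod_comp,
        pow_comp, add_comp, X_comp, C_comp]
      congr 2
      refine Finset.prod_congr rfl fun n _ => ?_
      rw [add_assoc, ← C_add, add_sub_cancel]
  -- Every summand with index other than `k` contains the factor `(X + a k) ^ r k`.
  have hdvd (k : Fin T) : (X + C (a k)) ^ r k ∣ ∑ n, f n - 1 := by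
    rw [← Finset.add_sum_erase _ _ (Finset.mem_univ k), add_sub_right_comm]
    refine dvd_add (hdvd_self k) (Finset.dvd_sum fun n hn => ?_)
    refine Dvd.dvd.mul_right ?_ _
    exact Finset.dvd_prod_of_mem (fun n => (X + C (a n)) ^ r n)
      (Finset.mem_erase.2 ⟨(Finset.ne_of_mem_erase hn).symm, Finset.mem_univ _⟩)
  have hdvd_prod : ∏ n, (X + C (a n)) ^ r n ∣ ∑ n, f n - 1 := by
    refine Finset.prod_dvd_of_coprime (fun i _ j _ hij => ?_) fun k _ => hdvd k
    refine IsCoprime.pow ?_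
    have := Polynomial.isCoprime_X_sub_C_of_isUnit_sub (a := -a i) (b := -a j)
      (sub_ne_zero.2 fun h => hij (ha (neg_injective h))).isUnit
    simpa using this
  -- The difference is divisible by a product of degree `∑ r n` but has smaller degree, so it
  -- vanishes; `0 < T` makes the constant `1` of smaller degree.
  refine sub_eq_zero.1 (eq_zero_of_dvd_of_degree_lt hdvd_prod ?_)
  rw [hdegN]
  refine (degree_sub_le _ _).trans_lt (max_lt ?_ ?_)
  · refine (degree_sum_le _ _).trans_lt ((Finset.sup_lt_iff (WithBot.bot_lt_coe _)).2
      fun k _ => ?_)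
    rw [degree_mul, hdegN, ← Finset.sum_erase_add _ _ (Finset.mem_univ k), Nat.cast_add]
    refine WithBot.add_lt_add_left (WithBot.coe_ne_bot) ?_
    rw [degree_comp (by rw [degree_X_add_C]; exact zero_lt_one), degree_X_add_C,
      mul_one]
    exact PowerSeries.degree_trunc_lt _ _
  · rw [degree_one]
    have : 0 < ∑ n, r n := (hr ⟨0, hT⟩).trans_lt' zero_lt_one |>.trans_le
      (Finset.single_le_sum (fun _ _ => Nat.zero_le _) (Finset.mem_univ _))
    exact_mod_cast this

lemma prod_inv_pow_eq_sum (hT : 0 < T) {a : Fin T → ℝ} (ha : Function.Injective a)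
    {r : Fin T → ℕ} (hr : ∀ n, 1 ≤ r n) {z : ℂ} (hz : ∀ n, z + a n ≠ 0) :
    ∏ n, ((z + a n) ^ r n)⁻¹ = ∑ k, ∑ j ∈ Finset.range (r k),
      ((PowerSeries.coeff j (cofactorSeries a r k) : ℝ) : ℂ) * ((z + a k) ^ (r k - j))⁻¹ := by
  have h := congrArg (Polynomial.aeval z) (sum_cofactor_mul_trunc_eq_one hT ha hr)
  rw [map_sum, map_one] at h
  rw [Finset.prod_inv_distrib, ← mul_one (∏ n, _)⁻¹, ← h, Finset.mul_sum]
  refine Finset.sum_congr rfl fun k _ => ?_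
  have hP : ∏ n ∈ Finset.univ.erase k, (z + a n) ^ r n ≠ 0 :=
    Finset.prod_ne_zero_iff.2 fun n _ => pow_ne_zero _ (hz n)
  rw [map_mul, map_prod, aeval_comp, ← Finset.mul_prod_erase _ _ (Finset.mem_univ k), mul_inv]
  simp only [map_pow, map_add, aeval_X, aeval_C, Complex.coe_algebraMap]
  rw [mul_assoc, inv_mul_cancel_left₀ hP, aeval_def, PowerSeries.eval₂_trunc_eq_sum_range,
    Finset.mul_sum]
  refine Finset.sum_congr rfl fun j hj => ?_
  rw [Complex.coe_algebraMap, mul_left_comm]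
  congr 1
  have hj' := (Finset.mem_range.1 hj).le
  rw [inv_mul_eq_iff_eq_mul₀ (pow_ne_zero _ (hz k)), ← Nat.sub_add_cancel hj', pow_add,
    Nat.sub_add_cancel hj', mul_right_comm, mul_inv_cancel₀ (pow_ne_zero _ (hz k)), one_mul]

end PartialFractions

/-! ### Characteristic functions of chi-squared sums -/

section Gaussian

open Complex

/-- The characteristic function of the square of a standard normal variable. -/
noncomputable def charFunGaussianSq (s : ℝ) : ℂ := ∫ x, cexp (s * x ^ 2 * I) ∂gaussianReal 0 1

lemma one_sub_mul_I_ne_zero (s : ℝ) : (1 - s * I : ℂ) ≠ 0 := fun h => by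
  simpa using congrArg Complex.re h

/-- The Gaussian integral gives a complex square root. Only its square is needed, since squares of
normals always come in pairs here, so no branch has to be followed. -/
lemma charFunGaussianSq_sq (s : ℝ) : charFunGaussianSq s ^ 2 = (1 - (2 * s : ℝ) * I)⁻¹ := by
  have hb : 0 < (1 / 2 - s * I : ℂ).re := by simp
  have h : charFunGaussianSq s = ((√(2 * Real.pi))⁻¹ : ℝ) *
      (Real.pi / (1 / 2 - s * I)) ^ (1 / 2 : ℂ) := by
    rw [charFunGaussianSq, integral_gaussianReal_eq_integral_smul one_ne_zero,
      ← integral_gaussian_complex hb, ← integral_const_mul]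
    refine integral_congr_ae (ae_of_all _ fun x => ?_)
    simp only [gaussianPDFReal, real_smul, ofReal_mul, ofReal_exp]
    rw [mul_assoc, ← Complex.exp_add]
    congr 2
    · simp
    · push_cast
      ring
  have hne := one_sub_mul_I_ne_zero (2 * s)
  have hne' : (1 / 2 - s * I : ℂ) ≠ 0 := fun h => by
    rw [h] at hb
    exact hb.ne rfl
  have hpi : (Real.pi : ℂ) ≠ 0 := ofReal_ne_zero.2 Real.pi_ne_zero
  rw [h, mul_pow, ← ofReal_pow, inv_pow, Real.sq_sqrt (by positivity), ← cpow_nat_mul]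
  norm_num
  push_cast at hne
  field_simp

variable {ι : Type*} [Fintype ι]

lemma charFun_map_sum_mul_sq (c : ι → ℝ) (u : ℝ) :
    charFun ((Measure.pi fun _ : ι => gaussianReal 0 1).map fun x => ∑ i, c i * x i ^ 2) u =
      ∏ i, charFunGaussianSq (u * c i) := by
  rw [charFun_apply_real, integral_map (Measurable.aemeasurable (by fun_prop)) (by fun_prop)]
  simp only [charFunGaussianSq]
  rw [← integral_fintype_prod_eq_prod (𝕜 := ℂ) (fun i (x : ℝ) => cexp ((u * c i : ℝ) * x ^ 2 * I))]
  refine integral_congr_ae (ae_of_all _ fun x => ?_)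
  simp only
  rw [← Complex.exp_sum]
  congr 1
  push_cast
  rw [Finset.mul_sum, Finset.sum_mul]
  refine Finset.sum_congr rfl fun i _ => ?_
  ring

instance isProbabilityMeasure_chiSquared (k : ℕ) : IsProbabilityMeasure (chiSquared k) :=
  Measure.isProbabilityMeasure_map (Measurable.aemeasurable (by fun_prop))

lemma charFun_chiSquared (r : ℕ) (u : ℝ) :
    charFun (chiSquared (2 * r)) u = ((1 - (2 * u : ℝ) * I) ^ r)⁻¹ := by
  have h := charFun_map_sum_mul_sq (fun _ : Fin (2 * r) => 1) u
  simp only [one_mul, mul_one, Finset.prod_const, Finset.card_univ, Fintype.card_fin, pow_mul,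
    charFunGaussianSq_sq, inv_pow] at h
  exact h

lemma charFun_map_weighted_chiSquared (δ : ι → ℝ) (r : ι → ℕ) (u : ℝ) :
    charFun ((Measure.pi fun t => chiSquared (2 * r t)).map
      fun q => ∑ t, 1 / 2 * δ t * q t) u = ∏ t, ((1 - (u * δ t : ℝ) * I) ^ r t)⁻¹ := by
  rw [charFun_apply_real, integral_map (Measurable.aemeasurable (by fun_prop)) (by fun_prop)]
  have h (t : ι) : ((1 - (u * δ t : ℝ) * I) ^ r t)⁻¹ =
      ∫ x, cexp ((u * (1 / 2 * δ t) : ℝ) * x * I) ∂chiSquared (2 * r t) := by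
    rw [← charFun_apply_real, charFun_chiSquared]
    congr 5
    ring
  simp only [h]
  rw [← integral_fintype_prod_eq_prod (𝕜 := ℂ)
    (fun t (x : ℝ) => cexp ((u * (1 / 2 * δ t) : ℝ) * x * I))]
  refine integral_congr_ae (ae_of_all _ fun x => ?_)
  simp only
  rw [← Complex.exp_sum]
  congr 1
  push_cast
  rw [Finset.mul_sum, Finset.sum_mul]
  refine Finset.sum_congr rfl fun i _ => ?_
  ring

end Gaussian

/-! ### Gamma laws with integer shape -/

section Gamma

open Complex Filter Topology Set

lemma integrableOn_pow_mul_cexp_neg_mul {c : ℂ} (hc : 0 < c.re) (n : ℕ) :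
    IntegrableOn (fun x : ℝ => (x : ℂ) ^ n * cexp (-c * x)) (Ioi 0) := by
  have h := integrableOn_rpow_mul_exp_neg_mul_rpow (p := 1) (s := n) (b := c.re)
    (by linarith [n.cast_nonneg (α := ℝ)]) one_pos hc
  refine (integrable_norm_iff ?_).1 (h.congr_fun (fun x hx => ?_) measurableSet_Ioi)
  · exact (by fun_prop : Continuous fun x : ℝ =>
      (x : ℂ) ^ n * cexp (-c * x)).aestronglyMeasurable
  · simp [Complex.norm_exp, abs_of_pos hx.out]

/-- Integration by parts: `x^(n+1) e^(-cx)` vanishes at both ends of the half-line, which links the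
integrals for `n + 1` and `n`. -/
lemma integral_pow_mul_cexp_neg_mul {c : ℂ} (hc : 0 < c.re) (n : ℕ) :
    ∫ x : ℝ in Ioi 0, (x : ℂ) ^ n * cexp (-c * x) = n.factorial / c ^ (n + 1) := by
  have hc0 : c ≠ 0 := fun h => by simp [h] at hc
  induction n with
  | zero =>
    have := integral_exp_mul_complex_Ioi (a := -c) (by simpa using hc) 0
    simp only [pow_zero, one_mul, this]
    simp
  | succ n ih =>
    have hderiv : ∀ x ∈ Ici (0 : ℝ), HasDerivAt (fun x : ℝ => (x : ℂ) ^ (n + 1) * cexp (-c * x))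
        ((n + 1) * ((x : ℂ) ^ n * cexp (-c * x)) - c * ((x : ℂ) ^ (n + 1) * cexp (-c * x))) x := by
      intro x _
      have h1 : HasDerivAt (fun z : ℂ => z ^ (n + 1) * cexp (-c * z))
          ((n + 1) * ((x : ℂ) ^ n * cexp (-c * x)) - c * ((x : ℂ) ^ (n + 1) * cexp (-c * x))) x := by
        have h2 := (hasDerivAt_pow (n + 1) (x : ℂ)).mul
          (((hasDerivAt_id (x : ℂ)).const_mul (-c)).cexp)
        convert! h2 using 1
        simp
        ring
      exact h1.comp_ofReal
    have hint1 := (integrableOn_pow_mul_cexp_neg_mul hc n).const_mul (n + 1 : ℂ)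
    have hint2 := (integrableOn_pow_mul_cexp_neg_mul hc (n + 1)).const_mul c
    have hlim : Tendsto (fun x : ℝ => (x : ℂ) ^ (n + 1) * cexp (-c * x)) atTop (𝓝 0) := by
      rw [tendsto_zero_iff_norm_tendsto_zero]
      refine (tendsto_rpow_mul_exp_neg_mul_atTop_nhds_zero (n + 1 : ℕ) c.re hc).congr' ?_
      filter_upwards [eventually_gt_atTop 0] with x hx
      rw [Real.rpow_natCast]
      simp [Complex.norm_exp, abs_of_pos hx]
    have h := integral_Ioi_of_hasDerivAt_of_tendsto' hderiv (hint1.sub hint2) hlim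
    rw [integral_sub hint1 hint2, integral_const_mul, integral_const_mul, ih] at h
    simp only [ofReal_zero, ne_eq, Nat.add_eq_zero_iff, one_ne_zero, and_false, not_false_eq_true,
      zero_pow, zero_mul, sub_zero] at h
    rw [eq_div_iff (pow_ne_zero _ hc0), pow_succ' c (n + 1), ← mul_assoc, mul_comm _ c,
      ← sub_eq_zero.1 h, Nat.factorial_succ]
    push_cast
    field_simp

lemma gammaPDFReal_natCast (n : ℕ) (β : ℝ) :
    gammaPDFReal (n + 1 : ℕ) β =
      (Ici 0).indicator fun x => β ^ (n + 1) / n.factorial * x ^ n * Real.exp (-(β * x)) := by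
  ext x
  rw [gammaPDFReal, indicator_apply]
  refine if_congr Iff.rfl ?_ rfl
  rw [Real.rpow_natCast, Nat.cast_add_one, Real.Gamma_nat_eq_factorial, add_sub_cancel_right,
    Real.rpow_natCast]

lemma charFun_gammaMeasure {m : ℕ} (hm : 1 ≤ m) {β : ℝ} (hβ : 0 < β) (u : ℝ) :
    charFun (gammaMeasure m β) u = β ^ m * ((β - u * I) ^ m)⁻¹ := by
  obtain ⟨n, rfl⟩ : ∃ n, m = n + 1 := ⟨m - 1, by omega⟩
  have hre : 0 < (β - u * I : ℂ).re := by simpa using hβ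
  rw [charFun_apply_real, gammaMeasure, integral_withDensity_eq_integral_toReal_smul
    (by unfold gammaPDF; fun_prop) (ae_of_all _ fun x => by simp [gammaPDF])]
  calc ∫ x, (gammaPDF (n + 1 : ℕ) β x).toReal • cexp (u * x * I)
      = ∫ x, (Ici (0 : ℝ)).indicator (fun x : ℝ => (β ^ (n + 1) / n.factorial : ℂ) *
          ((x : ℂ) ^ n * cexp (-(β - u * I) * x))) x := by
        refine integral_congr_ae (ae_of_all _ fun x => ?_)
        simp only
        rw [gammaPDF, ENNReal.toReal_ofReal (gammaPDFReal_nonneg (by positivity) hβ x),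
          gammaPDFReal_natCast]
        by_cases hx : x ∈ Ici (0 : ℝ)
        · simp only [indicator_of_mem hx, real_smul, ofReal_mul, ofReal_div, ofReal_pow,
            ofReal_natCast, ofReal_exp]
          rw [mul_assoc, mul_assoc, mul_assoc, ← Complex.exp_add]
          congr 4
          push_cast
          ring
        · simp [indicator_of_notMem hx]
    _ = β ^ (n + 1) * ((β - u * I) ^ (n + 1))⁻¹ := by
        rw [integral_indicator measurableSet_Ici, integral_Ici_eq_integral_Ioi, integral_const_mul,
          integral_pow_mul_cexp_neg_mul hre]
        have := n.factorial_ne_zero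
        field_simp

/-- The derivative of the sum telescopes and only its last term survives; this provides an
antiderivative of the gamma density. -/
lemma hasDerivAt_exp_neg_mul_sum (β x : ℝ) (n : ℕ) :
    HasDerivAt (fun x => -(Real.exp (-(β * x)) *
        ∑ u ∈ Finset.range (n + 1), (β * x) ^ u / (u.factorial : ℝ)))
      (β ^ (n + 1) / n.factorial * x ^ n * Real.exp (-(β * x))) x := by
  have hexp : HasDerivAt (fun x => Real.exp (-(β * x))) (Real.exp (-(β * x)) * -β) x := by
    simpa using ((hasDerivAt_id x).const_mul β).neg.exp
  induction n with
  | zero =>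
    convert! hexp.neg using 1
    · ext y
      simp
    · simp
      ring
  | succ n ih =>
    have hpow : HasDerivAt (fun x => (β * x) ^ (n + 1) / ((n + 1).factorial : ℝ))
        ((n + 1 : ℕ) * (β * x) ^ n * β / ((n + 1).factorial : ℝ)) x := by
      simpa using (((hasDerivAt_id x).const_mul β).pow (n + 1)).div_const _
    convert! ih.sub (hexp.mul hpow) using 1
    · ext y
      simp only [Pi.sub_apply, Pi.mul_apply]
      rw [Finset.sum_range_succ _ (n + 1)]
      ring
    · have := n.factorial_ne_zero
      rw [Nat.factorial_succ]
      push_cast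
      field_simp
      ring

lemma gammaMeasure_real_Iio {m : ℕ} (hm : 1 ≤ m) {β : ℝ} (hβ : 0 < β) {α : ℝ} (hα : 0 ≤ α) :
    (gammaMeasure m β).real (Iio α) =
      1 - Real.exp (-(β * α)) * ∑ u ∈ Finset.range m, (β * α) ^ u / (u.factorial : ℝ) := by
  obtain ⟨n, rfl⟩ : ∃ n, m = n + 1 := ⟨m - 1, by omega⟩
  have hpos : (0 : ℝ) < (n + 1 : ℕ) := by positivity
  have := isProbabilityMeasure_gammaMeasure hpos hβ
  have hIio : (gammaMeasure (n + 1 : ℕ) β).real (Iio α) =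
      (gammaMeasure (n + 1 : ℕ) β).real (Iic α) :=
    measureReal_congr ((withDensity_absolutelyContinuous _ _).ae_eq Iio_ae_eq_Iic)
  rw [hIio, ← cdf_eq_real, cdf_gammaMeasure_eq_integral hpos hβ, gammaPDFReal_natCast,
    setIntegral_indicator measurableSet_Ici, inter_comm, Ici_inter_Iic, integral_Icc_eq_integral_Ioc,
    ← intervalIntegral.integral_of_le hα,
    intervalIntegral.integral_eq_sub_of_hasDerivAt
      (fun x _ => hasDerivAt_exp_neg_mul_sum β x n)
      (Continuous.intervalIntegrable (by fun_prop) _ _)]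
  have h0 : ∑ u ∈ Finset.range (n + 1), (β * 0) ^ u / (u.factorial : ℝ) = 1 := by
    rw [Finset.sum_range_succ']
    simp
  rw [h0]
  simp
  ring

end Gamma

/-! ### Signed combinations of measures -/

section Mixture

lemma charFun_add_measure {μ ν : Measure ℝ} [IsFiniteMeasure μ] [IsFiniteMeasure ν] (t : ℝ) :
    charFun (μ + ν) t = charFun μ t + charFun ν t := by
  have h (ρ : Measure ℝ) [IsFiniteMeasure ρ] :
      Integrable (fun x : ℝ => Complex.exp (t * x * Complex.I)) ρ := by
    refine Integrable.of_bound (C := 1) (by fun_prop) (ae_of_all _ fun x => ?_)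
    rw [← Complex.ofReal_mul, Complex.norm_exp_ofReal_mul_I]
  simp only [charFun_apply_real]
  exact integral_add_measure (h μ) (h ν)

lemma charFun_sum_smul_measure {ι : Type*} (s : Finset ι) (ν : ι → Measure ℝ)
    [∀ i, IsFiniteMeasure (ν i)] (c : ι → NNReal) (t : ℝ) :
    charFun (∑ i ∈ s, c i • ν i) t = ∑ i ∈ s, ((c i : ℝ) : ℂ) * charFun (ν i) t := by
  classical
  induction s using Finset.induction_on with
  | empty => simp
  | insert i s hi ih =>
    rw [Finset.sum_insert hi, Finset.sum_insert hi, charFun_add_measure, ih]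
    simp only [charFun_apply_real, integral_smul_nnreal_measure]
    congr 1

/-- The coefficients may be negative, so each is split into positive and negative parts and the
negative ones are moved to the other side. Uniqueness of characteristic functions then applies to
two genuine finite measures. -/
lemma measureReal_eq_sum_of_charFun_eq_sum {ι : Type*} [Fintype ι] {μ : Measure ℝ}
    [IsFiniteMeasure μ] {ν : ι → Measure ℝ} [∀ i, IsFiniteMeasure (ν i)] {c : ι → ℝ}
    (h : ∀ t, charFun μ t = ∑ i, (c i : ℂ) * charFun (ν i) t) (A : Set ℝ) :
    μ.real A = ∑ i, c i * (ν i).real A := by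
  have hc (i : ι) : c i = (c i).toNNReal - (-c i).toNNReal := by
    rw [Real.coe_toNNReal', Real.coe_toNNReal']
    exact (posPart_sub_negPart (c i)).symm
  have hmeas : μ + ∑ i, (-c i).toNNReal • ν i = ∑ i, (c i).toNNReal • ν i := by
    refine Measure.ext_of_charFun (funext fun t => ?_)
    rw [charFun_add_measure, charFun_sum_smul_measure, charFun_sum_smul_measure, h,
      ← Finset.sum_add_distrib]
    refine Finset.sum_congr rfl fun i _ => ?_
    rw [← add_mul]
    congr 1
    rw [← Complex.ofReal_add]
    congr 1
    linarith [hc i]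
  have hsum (d : ι → NNReal) : (∑ i, d i • ν i).real A = ∑ i, (d i : ℝ) * (ν i).real A := by
    simp only [Measure.real, Measure.finsetSum_apply, Measure.smul_apply]
    rw [ENNReal.toReal_sum fun i _ => by
      rw [ENNReal.smul_def]
      exact ENNReal.mul_ne_top ENNReal.coe_ne_top (measure_ne_top _ _)]
    simp [ENNReal.smul_def]
  have hA := congrArg (fun ρ => ρ.real A) hmeas
  rw [measureReal_add_apply, hsum, hsum] at hA
  rw [eq_sub_of_add_eq hA, ← Finset.sum_sub_distrib]
  refine Finset.sum_congr rfl fun i _ => ?_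
  rw [← sub_mul, ← hc]

end Mixture

/-! ### The closed form of the distribution function -/

section ClosedForm

variable {T : ℕ}

/-- With `s = j + 1` the two signs combine to an exponent of the same parity as `j`, which is the
sign of the power series coefficient. -/
lemma neg_one_pow_mul_Psi (δ : Fin T → ℝ) (r : Fin T → ℕ) (k : Fin T) {j : ℕ} (hj : j < r k) :
    (-1) ^ (r k - (j + 1)) * Psi δ r k (j + 1) =
      PowerSeries.coeff j (cofactorSeries (fun t => 1 / δ t) r k) := by
  rw [coeff_cofactorSeries, Psi, ← mul_assoc, ← pow_add]
  congr 1
  rw [show r k - (j + 1) + (r k - 1) = 2 * (r k - (j + 1)) + j by omega, pow_add, pow_mul]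
  simp

lemma closedFormCDF_eq (δ : Fin T → ℝ) (r : Fin T → ℕ) (α : ℝ) :
    closedFormCDF δ r α = ∑ k, ∑ j : Fin (r k), (∏ t, (1 / δ t) ^ r t) *
      (PowerSeries.coeff j (cofactorSeries (fun t => 1 / δ t) r k) * δ k ^ (r k - j)) *
        (1 - Real.exp (-(α / δ k)) *
          ∑ u ∈ Finset.range (r k - j), (α / δ k) ^ u / (u.factorial : ℝ)) := by
  rw [closedFormCDF, Finset.mul_sum]
  refine Finset.sum_congr rfl fun k _ => ?_
  rw [Fin.sum_univ_eq_sum_range (fun j => (∏ t, (1 / δ t) ^ r t) *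
      (PowerSeries.coeff j (cofactorSeries (fun t => 1 / δ t) r k) * δ k ^ (r k - j)) *
        (1 - Real.exp (-(α / δ k)) *
          ∑ u ∈ Finset.range (r k - j), (α / δ k) ^ u / (u.factorial : ℝ))),
    ← Finset.Ico_add_one_right_eq_Icc, Finset.sum_Ico_eq_sum_range, Finset.mul_sum,
    Nat.add_sub_cancel]
  refine Finset.sum_congr rfl fun j hj => ?_
  have hj' := Finset.mem_range.1 hj
  rw [← neg_one_pow_mul_Psi δ r k hj', add_comm 1 j, show r k - (j + 1) + 1 = r k - j by omega]
  ring

/-- The distribution function of a weighted sum of independent chi-squared variables with even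
degrees of freedom and different weights. -/
lemma map_weighted_chiSquared_real_Iio (hT : 0 < T) {δ : Fin T → ℝ} (hδ : Function.Injective δ)
    (hpos : ∀ t, 0 < δ t) {r : Fin T → ℕ} (hr : ∀ t, 1 ≤ r t) {α : ℝ} (hα : 0 ≤ α) :
    ((Measure.pi fun t => chiSquared (2 * r t)).map fun q => ∑ t, 1 / 2 * δ t * q t).real
      (Set.Iio α) = closedFormCDF δ r α := by
  have := Measure.isProbabilityMeasure_map (μ := Measure.pi fun t => chiSquared (2 * r t))
    (f := fun q => ∑ t, 1 / 2 * δ t * q t) (Measurable.aemeasurable (by fun_prop))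
  have hinj : Function.Injective fun t => 1 / δ t := fun s t hst => hδ (by simpa using hst)
  have hm (p : Σ k, Fin (r k)) : 1 ≤ r p.1 - p.2 := by
    have := p.2.2
    omega
  have (p : Σ k, Fin (r k)) :
      IsFiniteMeasure (gammaMeasure ((r p.1 - p.2 : ℕ) : ℝ) (1 / δ p.1)) := by
    have := isProbabilityMeasure_gammaMeasure (a := ((r p.1 - p.2 : ℕ) : ℝ)) (r := 1 / δ p.1)
      (by exact_mod_cast hm p) (one_div_pos.2 (hpos _))
    infer_instance
  -- The factor `δ k ^ (r k - j)` cancels the normalization `β ^ m` of the gamma characteristic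
  -- function at `β = 1 / δ k`, `m = r k - j`.
  rw [measureReal_eq_sum_of_charFun_eq_sum
    (ν := fun p : Σ k, Fin (r k) => gammaMeasure ((r p.1 - p.2 : ℕ) : ℝ) (1 / δ p.1))
    (c := fun p => (∏ t, (1 / δ t) ^ r t) *
      (PowerSeries.coeff p.2 (cofactorSeries (fun t => 1 / δ t) r p.1) *
        δ p.1 ^ (r p.1 - p.2))) fun u => ?_, closedFormCDF_eq, Fintype.sum_sigma]
  · refine Finset.sum_congr rfl fun k _ => Finset.sum_congr rfl fun j _ => ?_
    rw [gammaMeasure_real_Iio (hm ⟨k, j⟩) (one_div_pos.2 (hpos _)) hα, one_div_mul_eq_div]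
  · have hz (t : Fin T) : (-(u * Complex.I) + ((1 / δ t : ℝ) : ℂ)) ≠ 0 := fun h => by
      have := congrArg Complex.re h
      simp [(hpos t).ne'] at this
    have hfac (t : Fin T) : ((1 - (u * δ t : ℝ) * Complex.I) ^ r t)⁻¹ =
        (((1 / δ t) ^ r t : ℝ) : ℂ) * ((-(u * Complex.I) + ((1 / δ t : ℝ) : ℂ)) ^ r t)⁻¹ := by
      have : (δ t : ℂ) ≠ 0 := Complex.ofReal_ne_zero.2 (hpos t).ne'
      rw [Complex.ofReal_pow, ← inv_pow, ← inv_pow, ← mul_pow]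
      congr 1
      rw [Complex.ofReal_div, Complex.ofReal_one, one_div, ← mul_inv]
      congr 1
      push_cast
      field_simp
      ring
    rw [charFun_map_weighted_chiSquared, Finset.prod_congr rfl fun t _ => hfac t,
      Finset.prod_mul_distrib, prod_inv_pow_eq_sum hT hinj hr hz, Fintype.sum_sigma,
      Finset.mul_sum]
    refine Finset.sum_congr rfl fun k _ => ?_
    rw [← Fin.sum_univ_eq_sum_range (fun j =>
      ((PowerSeries.coeff j (cofactorSeries (fun t => 1 / δ t) r k) : ℝ) : ℂ) *
        ((-(u * Complex.I) + ((1 / δ k : ℝ) : ℂ)) ^ (r k - j))⁻¹), Finset.mul_sum]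
    refine Finset.sum_congr rfl fun j _ => ?_
    have hδk : (δ k : ℂ) ≠ 0 := Complex.ofReal_ne_zero.2 (hpos k).ne'
    rw [charFun_gammaMeasure (hm ⟨k, j⟩) (one_div_pos.2 (hpos _)), neg_add_eq_sub]
    push_cast
    rw [mul_assoc, mul_assoc, ← mul_assoc ((δ k : ℂ) ^ _), ← mul_pow, mul_one_div_cancel hδk,
      one_pow, one_mul]

end ClosedForm

/-! ### Linear images of circular Gaussian vectors -/

namespace IsCircularGaussian

variable {Ω : Type*} [MeasurableSpace Ω] {μ : Measure Ω} {M : ℕ}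
  {R : Matrix (Fin M) (Fin M) ℂ} {h : Ω → Fin M → ℂ} {m n : Type*}

lemma memLp_two_mulVec (hh : IsCircularGaussian h R μ) (E : Matrix m (Fin M) ℂ) (i : m) :
    MemLp (fun ω => (E *ᵥ h ω) i) 2 μ := by
  simp only [Matrix.mulVec, dotProduct]
  exact memLp_finsetSum _ fun k _ => (hh.gaussian.eval k).memLp_two.const_mul (E i k)

lemma integral_mulVec (hh : IsCircularGaussian h R μ) (E : Matrix m (Fin M) ℂ) (i : m) :
    ∫ ω, (E *ᵥ h ω) i ∂μ = 0 := by
  simp only [Matrix.mulVec, dotProduct]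
  rw [integral_finsetSum _ fun k _ => (hh.gaussian.eval k).integrable.const_mul (E i k)]
  simp [integral_const_mul, hh.mean]

lemma integral_mulVec_mul_conj (hh : IsCircularGaussian h R μ) (E : Matrix m (Fin M) ℂ)
    (F : Matrix n (Fin M) ℂ) (i : m) (j : n) :
    ∫ ω, (E *ᵥ h ω) i * conj ((F *ᵥ h ω) j) ∂μ = (E * R * Fᴴ) i j := by
  have hint (k l : Fin M) :
      Integrable (fun ω => E i k * conj (F j l) * (h ω k * conj (h ω l))) μ :=
    ((hh.gaussian.eval k).memLp_two.integrable_mul (hh.gaussian.eval l).memLp_two.star).const_mul _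
  have hexp (ω : Ω) : (E *ᵥ h ω) i * conj ((F *ᵥ h ω) j) =
      ∑ k, ∑ l, E i k * conj (F j l) * (h ω k * conj (h ω l)) := by
    simp only [Matrix.mulVec, dotProduct, map_sum, map_mul, Finset.sum_mul_sum]
    refine Finset.sum_congr rfl fun k _ => Finset.sum_congr rfl fun l _ => ?_
    ring
  simp only [hexp]
  rw [integral_finsetSum _ fun k _ => integrable_finsetSum _ fun l _ => hint k l]
  simp only [integral_finsetSum _ fun l _ => hint _ l, integral_const_mul, hh.covariance,
    Matrix.mul_apply, Matrix.conjTranspose_apply, Finset.sum_mul]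
  rw [Finset.sum_comm]
  refine Finset.sum_congr rfl fun k _ => Finset.sum_congr rfl fun l _ => ?_
  rw [mul_right_comm]
  rfl

lemma integral_mulVec_mul (hh : IsCircularGaussian h R μ) (E : Matrix m (Fin M) ℂ)
    (F : Matrix n (Fin M) ℂ) (i : m) (j : n) :
    ∫ ω, (E *ᵥ h ω) i * (F *ᵥ h ω) j ∂μ = 0 := by
  have hint (k l : Fin M) : Integrable (fun ω => E i k * F j l * (h ω k * h ω l)) μ :=
    ((hh.gaussian.eval k).memLp_two.integrable_mul (hh.gaussian.eval l).memLp_two).const_mul _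
  have hexp (ω : Ω) : (E *ᵥ h ω) i * (F *ᵥ h ω) j =
      ∑ k, ∑ l, E i k * F j l * (h ω k * h ω l) := by
    simp only [Matrix.mulVec, dotProduct, Finset.sum_mul_sum]
    refine Finset.sum_congr rfl fun k _ => Finset.sum_congr rfl fun l _ => ?_
    ring
  simp only [hexp]
  rw [integral_finsetSum _ fun k _ => integrable_finsetSum _ fun l _ => hint k l]
  simp only [integral_finsetSum _ fun l _ => hint _ l, integral_const_mul, hh.pseudoCovariance]
  simp

/-- A linear image of a circularly symmetric Gaussian vector is circularly symmetric Gaussian. -/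
lemma mulVec (hh : IsCircularGaussian h R μ) {r : ℕ} (E : Matrix (Fin r) (Fin M) ℂ) :
    IsCircularGaussian (fun ω => E *ᵥ h ω) (E * R * Eᴴ) μ where
  gaussian := hh.gaussian.map_fun (E.mulVecLin.toContinuousLinearMap.restrictScalars ℝ)
  mean := hh.integral_mulVec E
  covariance := hh.integral_mulVec_mul_conj E E
  pseudoCovariance := hh.integral_mulVec_mul E E

/-- The diagonal of the covariance holds the second absolute moments of the coordinates, all zero
here. -/
lemma mulVec_ae_eq_zero [Countable m] (hh : IsCircularGaussian h R μ) {E : Matrix m (Fin M) ℂ}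
    (hE : E * R * Eᴴ = 0) : ∀ᵐ ω ∂μ, E *ᵥ h ω = 0 := by
  have hi (i : m) : ∀ᵐ ω ∂μ, (E *ᵥ h ω) i = 0 := by
    have h0 := hh.integral_mulVec_mul_conj E E i i
    have hint := (hh.memLp_two_mulVec E i).integrable_norm_pow two_ne_zero
    simp only [hE, Matrix.zero_apply, Complex.mul_conj'] at h0
    have h1 : ∫ ω, ‖(E *ᵥ h ω) i‖ ^ 2 ∂μ = 0 := by
      rw [← Complex.ofReal_inj, ← integral_complex_ofReal]
      simpa using h0
    have h2 := (integral_eq_zero_iff_of_nonneg (fun ω => by positivity) hint).1 h1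
    filter_upwards [h2] with ω hω
    simpa using hω
  filter_upwards [ae_all_iff.2 hi] with ω hω
  exact funext hω

open scoped ComplexOrder in
-- The quadratic form at `x` is the second moment of `xᴴ E h`. Positivity of the beam covariance is
-- what lets its square root square back to it.
lemma posSemidef_mul_mul_conjTranspose [Finite m] (hh : IsCircularGaussian h R μ)
    (E : Matrix m (Fin M) ℂ) : (E * R * Eᴴ).PosSemidef := by
  classical
  have := Fintype.ofFinite m
  refine Matrix.PosSemidef.of_dotProduct_mulVec_nonneg ?_ fun x => ?_
  · ext i j
    rw [Matrix.conjTranspose_apply, ← hh.integral_mulVec_mul_conj, ← hh.integral_mulVec_mul_conj]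
    simp only [Complex.star_def, ← integral_conj, map_mul, Complex.conj_conj, mul_comm]
  · let F : Matrix Unit m ℂ := Matrix.of fun _ => star x
    have hF : star x ⬝ᵥ (E * R * Eᴴ) *ᵥ x = ((F * E) * R * (F * E)ᴴ) () () := by
      rw [Matrix.conjTranspose_mul, show F * E * R * (Eᴴ * Fᴴ) = F * ((E * R * Eᴴ) * Fᴴ) by
        simp only [Matrix.mul_assoc]]
      simp [F, Matrix.mul_apply, Matrix.mulVec, dotProduct]
    rw [hF, ← hh.integral_mulVec_mul_conj]
    simp only [Complex.mul_conj', ← Complex.ofReal_pow, integral_complex_ofReal]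
    exact Complex.zero_le_real.2 (integral_nonneg fun ω => by positivity)

end IsCircularGaussian

/-! ### Standard circular Gaussian vectors -/

section Standard

variable {Ω : Type*} [MeasurableSpace Ω] {μ : Measure Ω} {r : ℕ} {w : Ω → Fin r → ℂ}

/-- The real and imaginary parts of a complex vector, scaled by `√2`. -/
noncomputable def scaledParts {r : ℕ} (z : Fin r → ℂ) (p : Fin r × Bool) : ℝ :=
  √2 * if p.2 then (z p.1).im else (z p.1).re

lemma norm_sq_eq_scaledParts (z : Fin r → ℂ) (j : Fin r) :
    ‖z j‖ ^ 2 = 1 / 2 * (scaledParts z (j, false) ^ 2 + scaledParts z (j, true) ^ 2) := by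
  simp only [scaledParts, Complex.sq_norm, Complex.normSq_apply, mul_pow]
  norm_num
  ring

lemma hasGaussianLaw_scaledParts (hw : HasGaussianLaw w μ) :
    HasGaussianLaw (fun ω p => scaledParts (w ω) p) μ := by
  let L : (Fin r → ℂ) →L[ℝ] (Fin r × Bool → ℝ) := ContinuousLinearMap.pi fun p =>
    √2 • ((if p.2 then Complex.imCLM else Complex.reCLM).comp (ContinuousLinearMap.proj p.1))
  have h : (fun ω p => scaledParts (w ω) p) = fun ω => L (w ω) := by
    ext ω p
    rcases p with ⟨j, _ | _⟩ <;> simp [L, scaledParts]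
  rw [h]
  exact hw.map_fun L

lemma integral_scaledParts (hw : IsCircularGaussian w 1 μ) (p : Fin r × Bool) :
    ∫ ω, scaledParts (w ω) p ∂μ = 0 := by
  have hint := (hw.gaussian.eval p.1).integrable
  have hre : ∫ ω, (w ω p.1).re ∂μ = 0 := by
    have := integral_re hint
    simpa [hw.mean] using this
  have him : ∫ ω, (w ω p.1).im ∂μ = 0 := by
    have := integral_im hint
    simpa [hw.mean] using this
  rcases p with ⟨j, _ | _⟩ <;> simp [scaledParts, integral_const_mul, hre, him]

/-- Products of real and imaginary parts are half sums or differences of parts of `z w̄` and `z w`,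
so covariance and pseudo-covariance determine them. The factor `√2` makes the variances 1. -/
lemma integral_scaledParts_mul (hw : IsCircularGaussian w 1 μ) (p q : Fin r × Bool) :
    ∫ ω, scaledParts (w ω) p * scaledParts (w ω) q ∂μ = if p = q then 1 else 0 := by
  have h2 (j : Fin r) : MemLp (fun ω => w ω j) 2 μ := (hw.gaussian.eval j).memLp_two
  have hc (i j : Fin r) : Integrable (fun ω => w ω i * conj (w ω j)) μ :=
    (h2 i).integrable_mul (h2 j).star
  have hp (i j : Fin r) : Integrable (fun ω => w ω i * w ω j) μ := (h2 i).integrable_mul (h2 j)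
  have hcre (i j : Fin r) : ∫ ω, (w ω i * conj (w ω j)).re ∂μ = if i = j then 1 else 0 := by
    have := integral_re (hc i j)
    simp only [RCLike.re_to_complex, hw.covariance, Matrix.one_apply] at this
    rw [this]
    split_ifs <;> simp
  have hcim (i j : Fin r) : ∫ ω, (w ω i * conj (w ω j)).im ∂μ = 0 := by
    have := integral_im (hc i j)
    simp only [RCLike.im_to_complex, hw.covariance, Matrix.one_apply] at this
    rw [this]
    split_ifs <;> simp
  have hpre (i j : Fin r) : ∫ ω, (w ω i * w ω j).re ∂μ = 0 := by
    have := integral_re (hp i j)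
    simpa only [RCLike.re_to_complex, hw.pseudoCovariance, Complex.zero_re] using this
  have hpim (i j : Fin r) : ∫ ω, (w ω i * w ω j).im ∂μ = 0 := by
    have := integral_im (hp i j)
    simpa only [RCLike.im_to_complex, hw.pseudoCovariance, Complex.zero_im] using this
  have hcr (i j : Fin r) : Integrable (fun ω => (w ω i * conj (w ω j)).re) μ := (hc i j).re
  have hci (i j : Fin r) : Integrable (fun ω => (w ω i * conj (w ω j)).im) μ := (hc i j).im
  have hpr (i j : Fin r) : Integrable (fun ω => (w ω i * w ω j).re) μ := (hp i j).re
  have hpi (i j : Fin r) : Integrable (fun ω => (w ω i * w ω j).im) μ := (hp i j).im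
  have hs : √2 * √2 = 2 := Real.mul_self_sqrt (by norm_num)
  obtain ⟨i, a⟩ := p
  obtain ⟨j, b⟩ := q
  have key (x y : ℝ) : (√2 * x) * (√2 * y) = 2 * (x * y) := by rw [mul_mul_mul_comm, hs]
  rcases a with _ | _ <;> rcases b with _ | _ <;>
    simp only [scaledParts, key, if_true, Bool.false_eq_true, if_false, Prod.mk.injEq, and_true,
      and_false, Bool.true_eq_false]
  · have (ω : Ω) : 2 * ((w ω i).re * (w ω j).re) =
        (w ω i * conj (w ω j)).re + (w ω i * w ω j).re := by simp; ring
    simp only [this]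
    rw [integral_add (hcr i j) (hpr i j), hcre, hpre, add_zero]
  · have (ω : Ω) : 2 * ((w ω i).re * (w ω j).im) =
        (w ω i * w ω j).im - (w ω i * conj (w ω j)).im := by simp; ring
    simp only [this]
    rw [integral_sub (hpi i j) (hci i j), hcim, hpim, sub_zero]
  · have (ω : Ω) : 2 * ((w ω i).im * (w ω j).re) =
        (w ω i * w ω j).im + (w ω i * conj (w ω j)).im := by simp; ring
    simp only [this]
    rw [integral_add (hpi i j) (hci i j), hcim, hpim, add_zero]
  · have (ω : Ω) : 2 * ((w ω i).im * (w ω j).im) =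
        (w ω i * conj (w ω j)).re - (w ω i * w ω j).re := by simp; ring
    simp only [this]
    rw [integral_sub (hcr i j) (hpr i j), hcre, hpre, sub_zero]

/-- Jointly Gaussian uncorrelated coordinates are independent. -/
lemma map_scaledParts (hw : IsCircularGaussian w 1 μ) :
    μ.map (fun ω p => scaledParts (w ω) p) = Measure.pi fun _ => gaussianReal 0 1 := by
  have hG := hasGaussianLaw_scaledParts hw.gaussian
  have := hG.isProbabilityMeasure
  have hcov (p q : Fin r × Bool) :
      cov[fun ω => scaledParts (w ω) p, fun ω => scaledParts (w ω) q; μ] =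
        if p = q then 1 else 0 := by
    rw [covariance_eq_sub (hG.eval p).memLp_two (hG.eval q).memLp_two, integral_scaledParts hw,
      zero_mul, sub_zero]
    exact integral_scaledParts_mul hw p q
  have hind : iIndepFun (fun p ω => scaledParts (w ω) p) μ :=
    hG.iIndepFun_of_covariance_eq_zero fun p q hpq => by rw [hcov, if_neg hpq]
  rw [(iIndepFun_iff_map_fun_eq_pi_map fun p => (hG.eval p).aemeasurable).1 hind]
  congr 1
  ext1 p
  rw [(hG.eval p).map_eq_gaussianReal, integral_scaledParts hw,
    ← covariance_self (hG.eval p).aemeasurable, hcov, if_pos rfl, Real.toNNReal_one]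

lemma charFun_map_weighted_norm_sq (hw : IsCircularGaussian w 1 μ) (δ : Fin r → ℝ) (u : ℝ) :
    charFun (μ.map fun ω => ∑ j, δ j * ‖w ω j‖ ^ 2) u =
      ∏ j, (1 - (u * δ j : ℝ) * Complex.I)⁻¹ := by
  have hmap : μ.map (fun ω => ∑ j, δ j * ‖w ω j‖ ^ 2) =
      (Measure.pi fun _ : Fin r × Bool => gaussianReal 0 1).map
        fun x => ∑ p, δ p.1 / 2 * x p ^ 2 := by
    rw [← map_scaledParts hw, AEMeasurable.map_map_of_aemeasurable
      (Measurable.aemeasurable (by fun_prop)) (hasGaussianLaw_scaledParts hw.gaussian).aemeasurable]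
    congr 1
    ext ω
    simp only [Function.comp_apply, Fintype.sum_prod_type, Fintype.sum_bool]
    refine Finset.sum_congr rfl fun j _ => ?_
    rw [norm_sq_eq_scaledParts]
    ring
  rw [hmap, charFun_map_sum_mul_sq, Fintype.prod_prod_type]
  refine Finset.prod_congr rfl fun j _ => ?_
  -- The real and imaginary parts contribute equal factors, giving the square computed in
  -- `charFunGaussianSq_sq`.
  rw [Fintype.prod_bool, ← sq, charFunGaussianSq_sq]
  congr 4
  ring

end Standard

/-! ### Whitening and the law of the trained norm -/

section Norm

open scoped ComplexOrder in
lemma sqrtRows_mul_conjTranspose {M B : ℕ} {W : Matrix (Fin M) (Fin B) ℂ}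
    {R : Matrix (Fin M) (Fin M) ℂ} (hR : (beamCovariance W R).PosSemidef) (b : ℕ) :
    sqrtRows W R b * (sqrtRows W R b)ᴴ =
      (beamCovariance W R).submatrix Subtype.val Subtype.val := by
  have hS := (Matrix.nonneg_iff_posSemidef.1 (CFC.sqrt_nonneg (beamCovariance W R))).isHermitian.eq
  have hSS := CFC.sqrt_mul_sqrt_self (beamCovariance W R) hR.nonneg
  rw [sqrtRows, Matrix.conjTranspose_submatrix, hS]
  conv_rhs => rw [← hSS]
  rw [Matrix.submatrix_mul _ _ _ id _ Function.bijective_id]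

variable {n : ℕ} {m : Type*} [Fintype m]

/-- Left inverse of `A * D.U` coming from a compact eigenvalue decomposition of `Aᴴ * A`. -/
noncomputable def whitening {A : Matrix m (Fin n) ℂ} (D : CompactEVD (Aᴴ * A)) :
    Matrix (Fin D.r) m ℂ :=
  Matrix.diagonal (fun j => ((D.δ j)⁻¹ : ℂ)) * D.Uᴴ * Aᴴ

variable {A : Matrix m (Fin n) ℂ} (D : CompactEVD (Aᴴ * A))

lemma CompactEVD.conjTranspose_U_mul {X : Matrix (Fin n) (Fin n) ℂ} (D : CompactEVD X) :
    D.Uᴴ * X = Matrix.diagonal (fun j => (D.δ j : ℂ)) * D.Uᴴ := by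
  refine (congrArg (D.Uᴴ * ·) D.decomposition).trans ?_
  simp only [← Matrix.mul_assoc]
  rw [D.semiunitary, Matrix.one_mul]

lemma CompactEVD.mul_U_mul_conjTranspose_U {X : Matrix (Fin n) (Fin n) ℂ} (D : CompactEVD X) :
    X * (D.U * D.Uᴴ) = X := by
  refine (congrArg (· * (D.U * D.Uᴴ)) D.decomposition).trans (Eq.trans ?_ D.decomposition.symm)
  rw [Matrix.mul_assoc, ← Matrix.mul_assoc D.Uᴴ, D.semiunitary, Matrix.one_mul]

lemma CompactEVD.diagonal_inv_mul_diagonal :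
    Matrix.diagonal (fun j => ((D.δ j)⁻¹ : ℂ)) * Matrix.diagonal (fun j => (D.δ j : ℂ)) = 1 := by
  rw [Matrix.diagonal_mul_diagonal, ← Matrix.diagonal_one]
  congr 1
  ext j
  exact inv_mul_cancel₀ (Complex.ofReal_ne_zero.2 (D.δ_pos j).ne')

lemma whitening_mul : whitening D * A = D.Uᴴ := by
  rw [whitening, Matrix.mul_assoc, Matrix.mul_assoc, D.conjTranspose_U_mul, ← Matrix.mul_assoc,
    D.diagonal_inv_mul_diagonal, Matrix.one_mul]

open scoped ComplexOrder in
-- `Y = A (1 - U Uᴴ)` satisfies `Yᴴ Y = 0`, because `AᴴA` is unchanged by right multiplication with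
-- `U Uᴴ`.
lemma mul_U_mul_conjTranspose_U : A * (D.U * D.Uᴴ) = A := by
  have h : (A * (1 - D.U * D.Uᴴ))ᴴ * (A * (1 - D.U * D.Uᴴ)) = 0 := by
    rw [Matrix.conjTranspose_mul, Matrix.mul_assoc, ← Matrix.mul_assoc Aᴴ, Matrix.mul_sub (Aᴴ * A),
      Matrix.mul_one, D.mul_U_mul_conjTranspose_U, sub_self, Matrix.mul_zero]
  rw [Matrix.conjTranspose_mul_self_eq_zero, Matrix.mul_sub, Matrix.mul_one, sub_eq_zero] at h
  exact h.symm

/-- The columns of `A U` are orthogonal with squared lengths `δ_j`. -/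
lemma sum_norm_sq_mulVec (z : Fin D.r → ℂ) :
    ∑ i, ‖((A * D.U) *ᵥ z) i‖ ^ 2 = ∑ j, D.δ j * ‖z j‖ ^ 2 := by
  have h : (A * D.U)ᴴ * (A * D.U) = Matrix.diagonal (fun j => (D.δ j : ℂ)) := by
    rw [Matrix.conjTranspose_mul, ← Matrix.mul_assoc, Matrix.mul_assoc D.Uᴴ,
      D.conjTranspose_U_mul, Matrix.mul_assoc, D.semiunitary, Matrix.mul_one]
  have h2 : star ((A * D.U) *ᵥ z) ⬝ᵥ ((A * D.U) *ᵥ z) =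
      star z ⬝ᵥ (Matrix.diagonal (fun j => (D.δ j : ℂ)) *ᵥ z) := by
    rw [Matrix.star_mulVec, Matrix.dotProduct_mulVec, Matrix.vecMul_vecMul, h,
      ← Matrix.dotProduct_mulVec]
  simp only [dotProduct, Pi.star_apply, Matrix.mulVec_diagonal, Complex.star_def] at h2
  rw [← Complex.ofReal_inj]
  push_cast
  simp only [← Complex.conj_mul']
  rw [h2]
  refine Finset.sum_congr rfl fun j _ => ?_
  ring

variable {Ω : Type*} [MeasurableSpace Ω] {μ : Measure Ω} {M B : ℕ}
  {R : Matrix (Fin M) (Fin M) ℂ} {h : Ω → Fin M → ℂ} {W : Matrix (Fin M) (Fin B) ℂ} {b : ℕ}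

lemma charFun_map_trainedNormSq (hh : IsCircularGaussian h R μ)
    {A : Matrix (trainedSet B b) (Fin B) ℂ} (hA : A = sqrtRows W R b) (D : CompactEVD (Aᴴ * A))
    (u : ℝ) :
    charFun (μ.map fun ω => trainedNormSq (beamChannel W (h ω)) b) u =
      ∏ j, (1 - (u * D.δ j : ℝ) * Complex.I)⁻¹ := by
  set G : Matrix (trainedSet B b) (Fin M) ℂ := Wᴴ.submatrix Subtype.val id with hG
  have hcov : G * R * Gᴴ = A * Aᴴ := by
    have hR := hh.posSemidef_mul_mul_conjTranspose Wᴴ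
    rw [Matrix.conjTranspose_conjTranspose] at hR
    rw [hA, sqrtRows_mul_conjTranspose hR, beamCovariance, hG, Matrix.conjTranspose_submatrix,
      Matrix.conjTranspose_conjTranspose]
    rfl
  -- The whitened vector has covariance `(whitening A)(whitening A)ᴴ = Uᴴ U = 1`.
  have hw : IsCircularGaussian (fun ω => (whitening D * G) *ᵥ h ω) 1 μ := by
    convert hh.mulVec (whitening D * G) using 1
    rw [Matrix.conjTranspose_mul, show whitening D * G * R * (Gᴴ * (whitening D)ᴴ) =
      whitening D * (G * R * Gᴴ) * (whitening D)ᴴ by simp only [Matrix.mul_assoc], hcov,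
      ← Matrix.mul_assoc, whitening_mul, Matrix.mul_assoc, ← Matrix.conjTranspose_mul,
      whitening_mul, Matrix.conjTranspose_conjTranspose, D.semiunitary]
  have hE : A - A * D.U * whitening D * A = 0 := by
    rw [Matrix.mul_assoc, whitening_mul, Matrix.mul_assoc, mul_U_mul_conjTranspose_U, sub_self]
  -- The residual `g - A U w` has zero covariance, so `g` is almost surely recovered from `w`.
  have hae := hh.mulVec_ae_eq_zero (E := G - A * D.U * whitening D * G) (by
    classical
    have hfac : G - A * D.U * whitening D * G = (1 - A * D.U * whitening D) * G := by
      rw [Matrix.sub_mul, Matrix.one_mul]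
    rw [hfac, Matrix.conjTranspose_mul, show (1 - A * D.U * whitening D) * G * R *
      (Gᴴ * (1 - A * D.U * whitening D)ᴴ) = (1 - A * D.U * whitening D) * (G * R * Gᴴ) *
        (1 - A * D.U * whitening D)ᴴ by simp only [Matrix.mul_assoc], hcov, ← Matrix.mul_assoc,
      Matrix.sub_mul, Matrix.one_mul, hE, Matrix.zero_mul, Matrix.zero_mul])
  rw [← charFun_map_weighted_norm_sq hw D.δ u]
  congr 1
  refine Measure.map_congr ?_
  filter_upwards [hae] with ω hω
  rw [Matrix.sub_mulVec, sub_eq_zero, Matrix.mul_assoc (A * D.U), ← Matrix.mulVec_mulVec] at hω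
  rw [trainedNormSq_eq_sum, ← sum_norm_sq_mulVec D, ← hω, ← Finset.sum_coe_sort]
  rfl

/-- The squared norm of the trained sub-vector is distributed as a weighted sum of independent
chi-squared variables. -/
lemma map_trainedNormSq [IsProbabilityMeasure μ] (hh : IsCircularGaussian h R μ)
    (D : CompactEVD ((sqrtRows W R b)ᴴ * sqrtRows W R b)) :
    μ.map (fun ω => trainedNormSq (beamChannel W (h ω)) b) =
      (Measure.pi fun t => chiSquared (2 * D.mult t)).map
        fun q => ∑ t, 1 / 2 * D.value t * q t := by
  have hmap : IsProbabilityMeasure ((Measure.pi fun t => chiSquared (2 * D.mult t)).map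
      fun q => ∑ t, 1 / 2 * D.value t * q t) :=
    Measure.isProbabilityMeasure_map (Measurable.aemeasurable (by fun_prop))
  refine Measure.ext_of_charFun (funext fun u => ?_)
  rw [charFun_map_trainedNormSq hh rfl D, charFun_map_weighted_chiSquared]
  have hmem (j : Fin D.r) : ∃ t, D.value t = D.δ j := by
    rw [← Set.mem_range, D.range_value]
    exact Set.mem_range_self j
  choose f hf using hmem
  -- The fibre of `f` over `t` consists of the `mult t` indices whose eigenvalue is `value t`.
  rw [← Finset.prod_fiberwise Finset.univ f]
  refine Finset.prod_congr rfl fun t _ => ?_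
  rw [Finset.prod_congr rfl (g := fun _ => (1 - (u * D.value t : ℝ) * Complex.I)⁻¹) fun j hj => by
    rw [← hf j, (Finset.mem_filter.1 hj).2], Finset.prod_const, inv_pow, D.mult_eq]
  congr 3
  ext j
  simp only [Finset.mem_filter, Finset.mem_univ, true_and]
  rw [← hf j]
  exact ⟨fun h => by rw [h], fun h => D.value_injective h⟩

lemma aemeasurable_beamChannel (hh : IsCircularGaussian h R μ) (W : Matrix (Fin M) (Fin B) ℂ) :
    AEMeasurable (fun ω => beamChannel W (h ω)) μ :=
  (hh.mulVec Wᴴ).gaussian.aemeasurable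

lemma measureReal_trainedNormSq_lt [IsProbabilityMeasure μ] (hh : IsCircularGaussian h R μ)
    (D : CompactEVD ((sqrtRows W R b)ᴴ * sqrtRows W R b)) (hr : 1 ≤ D.r) {α : ℝ} (hα : 0 ≤ α) :
    μ.real {ω | trainedNormSq (beamChannel W (h ω)) b < α} =
      closedFormCDF D.value D.mult α := by
  have hrange (t : Fin D.T) : ∃ j, D.δ j = D.value t := by
    rw [← Set.mem_range, ← D.range_value]
    exact Set.mem_range_self t
  have hpos (t : Fin D.T) : 0 < D.value t := by
    obtain ⟨j, hj⟩ := hrange t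
    rw [← hj]
    exact D.δ_pos j
  have hmult (t : Fin D.T) : 1 ≤ D.mult t := by
    obtain ⟨j, hj⟩ := hrange t
    rw [D.mult_eq, Nat.one_le_iff_ne_zero, Finset.card_ne_zero]
    exact ⟨j, by simpa using hj⟩
  -- Positive rank excludes an empty list of values, for which the closed form would be the empty
  -- sum `0`.
  have hT : 0 < D.T := by
    have : D.δ ⟨0, hr⟩ ∈ Set.range D.value := D.range_value ▸ Set.mem_range_self _
    obtain ⟨t, -⟩ := this
    exact t.pos
  rw [← map_weighted_chiSquared_real_Iio hT D.value_injective hpos hmult hα,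
    ← map_trainedNormSq hh D]
  exact (map_measureReal_apply_of_aemeasurable
    ((continuous_trainedNormSq b).measurable.comp_aemeasurable (aemeasurable_beamChannel hh W))
    measurableSet_Iio).symm

end Norm

lemma snrThreshold_nonneg {P Rth : ℝ} (hP : 0 < P) (hRth : 0 ≤ Rth) : 0 ≤ snrThreshold P Rth :=
  div_nonneg (sub_nonneg.2 (Real.one_le_rpow one_le_two hRth)) hP.le

end InterleavedTraining

theorem theorem1 {Ω : Type*} [MeasurableSpace Ω] (μ : Measure Ω) [IsProbabilityMeasure μ]
    (M B : ℕ) (hB : 1 ≤ B)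
    (R : Matrix (Fin M) (Fin M) ℂ) (h : Ω → Fin M → ℂ) (hh : IsCircularGaussian h R μ)
    (W : Matrix (Fin M) (Fin B) ℂ)
    (P Rth : ℝ) (hP : 0 < P) (hRth : 0 ≤ Rth)
    (D : (b : ℕ) → CompactEVD ((sqrtRows W R b)ᴴ * sqrtRows W R b)) :
    -- the training length has a finite mean, given by the outage probabilities
    Integrable (fun ω => (trainingLength (snrThreshold P Rth) (beamChannel W (h ω)) : ℝ)) μ ∧
    ∫ ω, (trainingLength (snrThreshold P Rth) (beamChannel W (h ω)) : ℝ) ∂μ =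
      1 + ∑ b ∈ Finset.Icc 1 (B - 1),
        μ.real {ω | trainedNormSq (beamChannel W (h ω)) b < snrThreshold P Rth} ∧
    -- each squared norm is a weighted sum of independent chi-squared variables
    (∀ b, 1 ≤ b → b ≤ B →
      μ.map (fun ω => trainedNormSq (beamChannel W (h ω)) b) =
        (Measure.pi fun t => chiSquared (2 * (D b).mult t)).map
          fun q => ∑ t, 1 / 2 * (D b).value t * q t) ∧
    -- closed form of each outage probability
    (∀ b, 1 ≤ b → b ≤ B → 1 ≤ (D b).r →
      μ.real {ω | trainedNormSq (beamChannel W (h ω)) b < snrThreshold P Rth} =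
        closedFormCDF (D b).value (D b).mult (snrThreshold P Rth)) ∧
    -- closed form of the average training length
    ((∀ b ∈ Finset.Icc 1 (B - 1), 1 ≤ (D b).r) →
      ∫ ω, (trainingLength (snrThreshold P Rth) (beamChannel W (h ω)) : ℝ) ∂μ =
        1 + ∑ b ∈ Finset.Icc 1 (B - 1),
          closedFormCDF (D b).value (D b).mult (snrThreshold P Rth)) := by
  have hα := snrThreshold_nonneg hP hRth
  have hmeas := aemeasurable_beamChannel hh W
  have hlen := integral_trainingLength hB hmeas (snrThreshold P Rth)
  refine ⟨integrable_trainingLength hB hmeas _, hlen, fun b _ _ => map_trainedNormSq hh (D b),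
    fun b _ _ hr => measureReal_trainedNormSq_lt hh (D b) hr hα, fun hr => ?_⟩
  rw [hlen]
  congr 1
  exact Finset.sum_congr rfl fun b hb => measureReal_trainedNormSq_lt hh (D b) (hr b hb) hα
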